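/- Let $q\in\mathbb C$ with $0<|q|<1$. Write $(a;q)_n=\prod_{j=0}^{n-1}(1-aq^j)$, $(a;q)_\infty=\prod_{j\ge0}(1-aq^j)$ and $(a,b;q)_n=(a;q)_n(b;q)_n$ (also for $n=\infty$), and let $\left(\frac{\cdot}{\cdot}\right)$ be the Kronecker symbol. Define the series (for arguments $q$ inside or outside the unit disc, wherever they converge) $$K(w;q)=\sum_{n\ge0}\frac{(-1)^nq^{n^2}(q;q^2)_n}{(wq^2,w^{-1}q^2;q^2)_n},\qquad K_1(w;q)=\sum_{n\ge1}\frac{(-1)^{n-1}q^{n^2}(q;q^2)_{n-1}}{(wq,w^{-1}q;q^2)_n},\qquad \kappa(w;q)=\sum_{n\ge0}\frac{q^{n+1}w^{-n}(wq^2;q^2)_n}{(wq;q^2)_{n+1}},$$ and, for $|q|<1$, the partial theta functions $$\psi_1(w;q)=-w-w^2\sum_{n\ge0}\left(\tfrac{12}{n}\right)w^{\frac{n-1}2}q^{\frac{n^2-1}{24}},\qquad \psi_2(w;q)=\sum_{n\ge0}w^nq^{\frac{n(n+1)}2},\qquad \psi_5(w;q)=\sum_{n\ge0}\left(\tfrac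 n3\right)(-w)^{n-1}q^{\frac{n^2-1}3},$$ and $$s_1(w;q)=\frac{(q;q^2)_\infty}{w\,(wq,w^{-1}q;q^2)_\infty}\left(w^{-1}\psi_1(w;q^2)+1\right),\qquad S_5(w;q)=\frac{w\,(q;q^2)_\infty}{(wq^2,w^{-1}q^2;q^2)_\infty}\,\psi_5(w;q).$$ Then, for $w \in \mathbb C$: 1. If $|w|>1$ and $w\ne q^{2\ell+1}$ for all integers $\ell\ge0$, the series $\kappa(w;q^{-1})$ converges absolutely and $$\kappa(w;q^{-1})=\frac1{1-w}\,\psi_2(w^{-1};q).$$ 2. If $w\ne0$, $w\neq1$ and $w\ne q^{2\ell+1}$ for all $\ell\in\mathbb Z$, the series $K_1(w;q^{-1})$ converges absolutely and $$K_1(w;q^{-1})=\frac{w}{w-1}\bigl(\psi_2(w;q)+s_1(w;q)\bigr).$$ 3. If $w\ne0$ and $w\ne q^{2\ell}$ for all $\ell\in\mathbb Z\setminus\{0\}$, the series $K(w;q^{-1})$ converges absolutely and $$K(w;q^{-1})=(1-w)\,\psi_2(w;q)+S_5(w;q).$$ -/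

import Mathlib

noncomputable section

namespace QSeries

/-- The finite `q`-Pochhammer symbol `(a; q)_n = ∏_{j=0}^{n-1} (1 - a q^j)`. -/
def poch (a q : ℂ) (n : ℕ) : ℂ := ∏ j ∈ Finset.range n, (1 - a * q ^ j)

/-- The infinite `q`-Pochhammer symbol `(a; q)_∞ = ∏_{j ≥ 0} (1 - a q^j)`, used for `|q| < 1`. -/
def pochInf (a q : ℂ) : ℂ := ∏' j : ℕ, (1 - a * q ^ j)

/-- The Kronecker symbol `(a / n)` for an integer `a` and a natural number `n`: it is
multiplicative in `n`, equals the Jacobi symbol for odd `n`, `(a / 2) = χ₈ a` is `0` for even `a`,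
`1` for `a ≡ ±1` and `-1` for `a ≡ ±3` modulo `8`, and `(a / 0)` is `1` if `a = ±1`, else `0`. -/
def kronecker (a : ℤ) (n : ℕ) : ℤ :=
  if n = 0 then (if a.natAbs = 1 then 1 else 0)
  else (ZMod.χ₈ (a : ZMod 8)) ^ (padicValNat 2 n) * jacobiSym a (n / 2 ^ padicValNat 2 n)

/-- The general term (`n ≥ 0`) of `K(w; q)`. -/
def KTerm (w q : ℂ) (n : ℕ) : ℂ :=
  (-1) ^ n * q ^ (n ^ 2) * poch q (q ^ 2) n /
    (poch (w * q ^ 2) (q ^ 2) n * poch (w⁻¹ * q ^ 2) (q ^ 2) n)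

/-- `K(w; q) = ∑_{n ≥ 0} (-1)^n q^{n²} (q; q²)_n / (w q², w⁻¹ q²; q²)_n`. -/
def K (w q : ℂ) : ℂ := ∑' n : ℕ, KTerm w q n

/-- The general term (`n ≥ 1`) of `K₁(w; q)`. -/
def K1Term (w q : ℂ) (n : ℕ) : ℂ :=
  (-1) ^ (n - 1) * q ^ (n ^ 2) * poch q (q ^ 2) (n - 1) /
    (poch (w * q) (q ^ 2) n * poch (w⁻¹ * q) (q ^ 2) n)

/-- `K₁(w; q) = ∑_{n ≥ 1} (-1)^{n-1} q^{n²} (q; q²)_{n-1} / (w q, w⁻¹ q; q²)_n`,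
summed over `n + 1` with `n ≥ 0`. -/
def K1 (w q : ℂ) : ℂ := ∑' n : ℕ, K1Term w q (n + 1)

/-- The general term (`n ≥ 0`) of `κ(w; q)`. -/
def kappaTerm (w q : ℂ) (n : ℕ) : ℂ :=
  q ^ (n + 1) * w⁻¹ ^ n * poch (w * q ^ 2) (q ^ 2) n / poch (w * q) (q ^ 2) (n + 1)

/-- `κ(w; q) = ∑_{n ≥ 0} q^{n+1} w^{-n} (w q²; q²)_n / (w q; q²)_{n+1}`. -/
def kappa (w q : ℂ) : ℂ := ∑' n : ℕ, kappaTerm w q n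

/-- `ψ₁(w; q) = -w - w² ∑_{n ≥ 0} (12 / n) w^{(n-1)/2} q^{(n²-1)/24}`. The symbol vanishes
unless `n` is coprime to `6`, and then `n ≥ 1` and both divisions of natural numbers are exact. -/
def psi1 (w q : ℂ) : ℂ :=
  -w - w ^ 2 * ∑' n : ℕ, (kronecker 12 n : ℂ) * w ^ ((n - 1) / 2) * q ^ ((n ^ 2 - 1) / 24)

/-- `ψ₂(w; q) = ∑_{n ≥ 0} w^n q^{n(n+1)/2}`. -/
def psi2 (w q : ℂ) : ℂ := ∑' n : ℕ, w ^ n * q ^ (n * (n + 1) / 2)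

/-- `ψ₅(w; q) = ∑_{n ≥ 0} (n / 3) (-w)^{n-1} q^{(n²-1)/3}`. The symbol vanishes
unless `n` is coprime to `3`, and then `n ≥ 1` and the division of natural numbers is exact. -/
def psi5 (w q : ℂ) : ℂ :=
  ∑' n : ℕ, (kronecker (n : ℤ) 3 : ℂ) * (-w) ^ (n - 1) * q ^ ((n ^ 2 - 1) / 3)

/-- `s₁(w; q) = (q; q²)_∞ / (w (w q, w⁻¹ q; q²)_∞) · (w⁻¹ ψ₁(w; q²) + 1)`. -/
def s1 (w q : ℂ) : ℂ :=
  pochInf q (q ^ 2) / (w * (pochInf (w * q) (q ^ 2) * pochInf (w⁻¹ * q) (q ^ 2))) *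
    (w⁻¹ * psi1 w (q ^ 2) + 1)

/-- `S₅(w; q) = w (q; q²)_∞ / (w q², w⁻¹ q²; q²)_∞ · ψ₅(w; q)`. -/
def S5 (w q : ℂ) : ℂ :=
  w * pochInf q (q ^ 2) / (pochInf (w * q ^ 2) (q ^ 2) * pochInf (w⁻¹ * q ^ 2) (q ^ 2)) *
    psi5 w q

end QSeries

end

/-!
Write `p = q²`, `c = (q; p)_∞`. Replacing `q` by `q⁻¹` in the summands turns the series into

* `K(w; q⁻¹) = ∑ p^n (q; p)_n / (w q², w⁻¹ q²; p)_n` (`KTerm_inv`),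
* `K₁(w; q⁻¹) = q ∑ p^n (q; p)_n / (w q, w⁻¹ q; p)_{n+1}` (`K1Term_inv`),
* `κ(w; q⁻¹) = -z ∑ z^n (z q²; p)_n / (z q; p)_{n+1}` with `z = w⁻¹` (`kappaTerm_inv`),

which converge absolutely since `|q| < 1` (and `|z| < 1` in the last case).

Each identity is then multiplied by the infinite product in its denominators. Both sides become
pole-free functions of `w ≠ 0`: the first two series become values of
`regSum p B a b = ∑ p^n (B; p)_n (a p^n, b p^n; p)_∞`, the third one becomes `kappaSum`. No analytic
continuation in `w` is needed, because both sides satisfy the same first order functional equation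
for `w ↦ w p`:

* on the series side by telescoping (`regSum_contiguous`, `kappaSum_eq_add_mul`);
* on the other side by shifting the summation index of the partial theta functions by one period
  of their coefficients (`psi2_eq_add_mul`, `psi5_eq_sub_mul`, `psi1Sum_eq_sub_mul`) and by the
  quasi-periodicity of the theta products.

The difference `D` of the two sides therefore satisfies `D(w) = -w³ q³ D(w p)` for `K`,
`D(w) = -w³ q² D(w p)` for `K₁`, and `D(z) = z² q³ (1 - z q) D(z p)` for `κ`. Along the orbit
`w p^k → 0` it grows at most like the theta majorant `(-x, -x⁻¹; |p|)_∞` with `x = |w p^k|` (and is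
bounded for `κ`), whose growth rate `x⁻¹` per step is beaten by the multiplier `w³`. Iterating the
equation gives `D = 0` (`eq_zero_of_theta_recurrence`). Finally, the excluded values of `w` are
exactly zeros of the infinite products (and `w = 1` for `K₁`), so one may divide by them.
-/

open Filter Topology

namespace QSeries

/-! ### Finite and infinite `q`-Pochhammer symbols -/

lemma poch_succ (a p : ℂ) (n : ℕ) : poch a p (n + 1) = poch a p n * (1 - a * p ^ n) :=
  Finset.prod_range_succ _ _

lemma poch_succ' (a p : ℂ) (n : ℕ) : poch a p (n + 1) = (1 - a) * poch (a * p) p n := by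
  simp only [poch, Finset.prod_range_succ', pow_zero, mul_one, pow_succ']
  rw [mul_comm]
  simp only [mul_assoc]

lemma summable_norm_mul_pow (a : ℂ) {p : ℂ} (hp : ‖p‖ < 1) :
    Summable fun j : ℕ => ‖-(a * p ^ j)‖ := by
  simp only [norm_neg, norm_mul, norm_pow]
  exact (summable_geometric_of_lt_one (norm_nonneg _) hp).mul_left _

lemma multipliable_one_sub_mul_pow (a : ℂ) {p : ℂ} (hp : ‖p‖ < 1) :
    Multipliable fun j : ℕ => 1 - a * p ^ j := by
  simpa only [sub_eq_add_neg] using multipliable_one_add_of_summable (summable_norm_mul_pow a hp)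

lemma tendsto_poch (a : ℂ) {p : ℂ} (hp : ‖p‖ < 1) :
    Tendsto (poch a p) atTop (𝓝 (pochInf a p)) :=
  (multipliable_one_sub_mul_pow a hp).tendsto_prod_tprod_nat

lemma pochInf_eq_mul (a : ℂ) {p : ℂ} (hp : ‖p‖ < 1) :
    pochInf a p = (1 - a) * pochInf (a * p) p := by
  refine tendsto_nhds_unique ((tendsto_add_atTop_iff_nat 1).2 (tendsto_poch a hp)) ?_
  simp only [poch_succ']
  exact (tendsto_poch _ hp).const_mul _

lemma poch_mul_pochInf (a : ℂ) {p : ℂ} (hp : ‖p‖ < 1) (n : ℕ) :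
    poch a p n * pochInf (a * p ^ n) p = pochInf a p := by
  induction n with
  | zero => simp [poch]
  | succ n ih =>
    rw [poch_succ, mul_assoc, ← ih, pochInf_eq_mul (a * p ^ n) hp, pow_succ, mul_assoc a]

lemma pochInf_ne_zero {a p : ℂ} (hp : ‖p‖ < 1) (h : ∀ j : ℕ, a * p ^ j ≠ 1) :
    pochInf a p ≠ 0 := by
  simp only [pochInf, sub_eq_add_neg]
  refine tprod_one_add_ne_zero_of_summable (fun j => ?_) (summable_norm_mul_pow a hp)
  rw [← sub_eq_add_neg]
  exact sub_ne_zero.2 (h j).symm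

lemma norm_pochInf_sub_one_le (a : ℂ) {p : ℂ} (hp : ‖p‖ < 1) :
    ‖pochInf a p - 1‖ ≤ Real.exp (‖a‖ * (1 - ‖p‖)⁻¹) - 1 := by
  refine le_of_tendsto ((tendsto_poch a hp).sub_const 1).norm (Eventually.of_forall fun n => ?_)
  have h := Finset.norm_prod_one_add_sub_one_le (Finset.range n) fun j => -(a * p ^ j)
  simp only [← sub_eq_add_neg] at h
  refine h.trans (sub_le_sub_right (Real.exp_le_exp.2 ?_) _)
  refine ((summable_norm_mul_pow a hp).sum_le_tsum _ fun _ _ => norm_nonneg _).trans_eq ?_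
  simp only [norm_neg, norm_mul, norm_pow, tsum_mul_left]
  rw [tsum_geometric_of_lt_one (norm_nonneg _) hp]

lemma tendsto_pochInf_mul_pow (a : ℂ) {p : ℂ} (hp : ‖p‖ < 1) :
    Tendsto (fun n : ℕ => pochInf (a * p ^ n) p) atTop (𝓝 1) := by
  rw [tendsto_iff_norm_sub_tendsto_zero]
  refine squeeze_zero (fun _ => norm_nonneg _) (fun n => norm_pochInf_sub_one_le _ hp) ?_
  have h : Tendsto (fun n : ℕ => ‖a * p ^ n‖ * (1 - ‖p‖)⁻¹) atTop (𝓝 0) := by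
    have := ((tendsto_pow_atTop_nhds_zero_of_norm_lt_one hp).const_mul a).norm.mul_const
      ((1 - ‖p‖)⁻¹)
    simpa using this
  simpa using ((Real.continuous_exp.tendsto 0).comp h).sub_const 1

/-- The majorant `(-x; r)_∞ = ∏_{j ≥ 0} (1 + x r^j)` of `(a; p)_n` and `(a; p)_∞` for
`x = |a|`, `r = |p|`. -/
noncomputable def pochMaj (x r : ℝ) : ℝ := ∏' j : ℕ, (1 + x * r ^ j)

lemma multipliable_one_add_mul_pow (x : ℝ) {r : ℝ} (h0 : 0 ≤ r) (h1 : r < 1) :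
    Multipliable fun j : ℕ => 1 + x * r ^ j := by
  refine multipliable_one_add_of_summable ?_
  simp only [norm_mul, norm_pow, Real.norm_of_nonneg h0]
  exact (summable_geometric_of_lt_one h0 h1).mul_left _

lemma prod_le_pochMaj {x r : ℝ} (hx : 0 ≤ x) (h0 : 0 ≤ r) (h1 : r < 1) (n : ℕ) :
    ∏ j ∈ Finset.range n, (1 + x * r ^ j) ≤ pochMaj x r := by
  refine Monotone.ge_of_tendsto ?_ (multipliable_one_add_mul_pow x h0 h1).tendsto_prod_tprod_nat n
  refine monotone_nat_of_le_succ fun n => ?_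
  rw [Finset.prod_range_succ]
  refine le_mul_of_one_le_right (Finset.prod_nonneg fun j _ => by positivity) ?_
  have : 0 ≤ x * r ^ n := by positivity
  linarith

lemma one_le_pochMaj {x r : ℝ} (hx : 0 ≤ x) (h0 : 0 ≤ r) (h1 : r < 1) : 1 ≤ pochMaj x r := by
  simpa using prod_le_pochMaj hx h0 h1 0

lemma pochMaj_mono {x y r : ℝ} (hx : 0 ≤ x) (hxy : x ≤ y) (h0 : 0 ≤ r) (h1 : r < 1) :
    pochMaj x r ≤ pochMaj y r := by
  refine le_of_tendsto (multipliable_one_add_mul_pow x h0 h1).tendsto_prod_tprod_nat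
    (Eventually.of_forall fun n => le_trans ?_ (prod_le_pochMaj (hx.trans hxy) h0 h1 n))
  exact Finset.prod_le_prod (fun j _ => by positivity) fun j _ => by gcongr

lemma pochMaj_eq_mul (x : ℝ) {r : ℝ} (h0 : 0 ≤ r) (h1 : r < 1) :
    pochMaj x r = (1 + x) * pochMaj (x * r) r := by
  have h := (multipliable_one_add_mul_pow x h0 h1).tendsto_prod_tprod_nat
  have h' := (multipliable_one_add_mul_pow (x * r) h0 h1).tendsto_prod_tprod_nat
  refine tendsto_nhds_unique ((tendsto_add_atTop_iff_nat 1).2 h) ?_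
  refine (h'.const_mul (1 + x)).congr fun n => ?_
  simp only [Finset.prod_range_succ', pow_zero, mul_one, pow_succ', mul_assoc, mul_comm (1 + x)]

lemma norm_poch_le {a p : ℂ} {x : ℝ} (hp : ‖p‖ < 1) (ha : ‖a‖ ≤ x) (n : ℕ) :
    ‖poch a p n‖ ≤ pochMaj x ‖p‖ := by
  refine le_trans ?_ (prod_le_pochMaj ((norm_nonneg _).trans ha) (norm_nonneg p) hp n)
  rw [poch, norm_prod]
  refine Finset.prod_le_prod (fun _ _ => norm_nonneg _) fun j _ => (norm_sub_le _ _).trans ?_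
  rw [norm_one, norm_mul, norm_pow]
  gcongr

lemma norm_pochInf_le {a p : ℂ} {x : ℝ} (hp : ‖p‖ < 1) (ha : ‖a‖ ≤ x) :
    ‖pochInf a p‖ ≤ pochMaj x ‖p‖ :=
  le_of_tendsto (tendsto_poch a hp).norm (Eventually.of_forall (norm_poch_le hp ha))

lemma norm_mul_pow_le {a p : ℂ} {x : ℝ} (hp : ‖p‖ < 1) (ha : ‖a‖ ≤ x) (n : ℕ) :
    ‖a * p ^ n‖ ≤ x := by
  rw [norm_mul, norm_pow]
  exact (mul_le_of_le_one_right (norm_nonneg _) (pow_le_one₀ (norm_nonneg _) hp.le)).trans ha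

/-! ### The contiguous relation for the regularised series -/

/-- The general term of `regSum`. -/
noncomputable def regTerm (p B a b : ℂ) (n : ℕ) : ℂ :=
  p ^ n * poch B p n * (pochInf (a * p ^ n) p * pochInf (b * p ^ n) p)

/-- The series `(a, b; p)_∞ ∑_{n ≥ 0} p^n (B; p)_n / (a, b; p)_n`, with the infinite products
absorbed into the summands, so that it makes sense for all `a` and `b`. -/
noncomputable def regSum (p B a b : ℂ) : ℂ := ∑' n : ℕ, regTerm p B a b n

lemma norm_regTerm_le {p B a b : ℂ} {x y : ℝ} (hp : ‖p‖ < 1) (ha : ‖a‖ ≤ x) (hb : ‖b‖ ≤ y)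
    (n : ℕ) :
    ‖regTerm p B a b n‖ ≤ ‖p‖ ^ n * (pochMaj ‖B‖ ‖p‖ * (pochMaj x ‖p‖ * pochMaj y ‖p‖)) := by
  have hx := one_le_pochMaj ((norm_nonneg a).trans ha) (norm_nonneg p) hp
  rw [regTerm, norm_mul, norm_mul, norm_mul, norm_pow, mul_assoc]
  have h1 := norm_poch_le (a := B) hp le_rfl n
  have h2 := norm_pochInf_le hp (norm_mul_pow_le hp ha n)
  have h3 := norm_pochInf_le hp (norm_mul_pow_le hp hb n)
  have h4 := (norm_nonneg _).trans h1
  gcongr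

lemma summable_regTerm {p : ℂ} (hp : ‖p‖ < 1) (B a b : ℂ) : Summable (regTerm p B a b) :=
  .of_norm_bounded ((summable_geometric_of_lt_one (norm_nonneg p) hp).mul_right _)
    (norm_regTerm_le hp le_rfl le_rfl)

lemma norm_regSum_le {p B a b : ℂ} {x y : ℝ} (hp : ‖p‖ < 1) (ha : ‖a‖ ≤ x) (hb : ‖b‖ ≤ y) :
    ‖regSum p B a b‖ ≤
      (1 - ‖p‖)⁻¹ * (pochMaj ‖B‖ ‖p‖ * (pochMaj x ‖p‖ * pochMaj y ‖p‖)) :=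
  tsum_of_norm_bounded ((hasSum_geometric_of_lt_one (norm_nonneg p) hp).mul_right _)
    (norm_regTerm_le hp ha hb)

lemma tsum_sub_of_tendsto {f : ℕ → ℂ} {l : ℂ} (hf : Tendsto f atTop (𝓝 l))
    (hs : Summable fun n => f (n + 1) - f n) : ∑' n, (f (n + 1) - f n) = l - f 0 := by
  refine tendsto_nhds_unique hs.hasSum.tendsto_sum_nat ?_
  simp only [Finset.sum_range_sub]
  exact hf.sub_const _

/-- The relation telescopes: its summand is the forward difference of
`μ (B; p)_n (a p^n, b p^n; p)_∞`. -/
lemma regSum_contiguous {p B a b k₁ k₂ μ : ℂ} (hp : ‖p‖ < 1) (h₁ : k₁ + k₂ = μ * (a + b - B))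
    (h₂ : k₁ * a + k₂ * b = μ * (a * b)) :
    k₁ * regSum p B a (b * p) + k₂ * regSum p B (a * p) b =
      μ * (pochInf B p - pochInf a p * pochInf b p) := by
  set C : ℕ → ℂ := fun n => μ * (poch B p n * (pochInf (a * p ^ n) p * pochInf (b * p ^ n) p))
  have hC : Tendsto C atTop (𝓝 (μ * pochInf B p)) := by
    have := ((tendsto_poch B hp).mul
      ((tendsto_pochInf_mul_pow a hp).mul (tendsto_pochInf_mul_pow b hp))).const_mul μ
    simpa using this
  have hs₁ := (summable_regTerm hp B a (b * p)).mul_left k₁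
  have hs₂ := (summable_regTerm hp B (a * p) b).mul_left k₂
  have hterm : ∀ n, k₁ * regTerm p B a (b * p) n + k₂ * regTerm p B (a * p) b n =
      C (n + 1) - C n := fun n => by
    have ha := pochInf_eq_mul (a * p ^ n) hp
    have hb := pochInf_eq_mul (b * p ^ n) hp
    have e : ∀ c : ℂ, c * p * p ^ n = c * p ^ n * p := fun c => by ring
    have e' : ∀ c : ℂ, c * p ^ (n + 1) = c * p ^ n * p := fun c => by ring
    simp only [C, regTerm, poch_succ, e, e', ha, hb]
    linear_combination (p ^ n * poch B p n * pochInf (a * p ^ n * p) p *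
      pochInf (b * p ^ n * p) p) * (h₁ - p ^ n * h₂)
  have := tsum_sub_of_tendsto hC ((hs₁.add hs₂).congr hterm)
  simp only [← hterm] at this
  rw [hs₁.tsum_add hs₂, tsum_mul_left, tsum_mul_left] at this
  rw [regSum, regSum, this]
  simp [C, poch]
  ring

/-! ### Uniqueness for the functional equations -/

lemma eq_zero_of_le_mul_succ {G ε : ℕ → ℝ} {C : ℝ} (h0 : ∀ k, 0 ≤ G k) (hC : ∀ k, G k ≤ C)
    (h : ∀ k, G k ≤ ε k * G (k + 1)) (hε : Tendsto ε atTop (𝓝 0)) : G 0 = 0 := by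
  -- From some index `K` on, each step of the recurrence halves the bound `C`.
  obtain ⟨K, hK⟩ := eventually_atTop.1 (hε.eventually_le_const (show (0 : ℝ) < 1 / 2 by norm_num))
  have hpow : ∀ j k, K ≤ k → G k ≤ (1 / 2) ^ j * C := by
    intro j
    induction j with
    | zero => simpa using fun k _ => hC k
    | succ j ih =>
      intro k hk
      calc G k ≤ ε k * G (k + 1) := h k
        _ ≤ 1 / 2 * G (k + 1) := mul_le_mul_of_nonneg_right (hK k hk) (h0 _)
        _ ≤ 1 / 2 * ((1 / 2) ^ j * C) := by gcongr; exact ih _ (by omega)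
        _ = (1 / 2) ^ (j + 1) * C := by ring
  have hlim : Tendsto (fun j : ℕ => (1 / 2 : ℝ) ^ j * C) atTop (𝓝 0) := by
    simpa using (tendsto_pow_atTop_nhds_zero_of_lt_one (by norm_num : (0 : ℝ) ≤ 1 / 2)
      (by norm_num)).mul_const C
  have hGK : G K = 0 := (ge_of_tendsto' hlim fun j => hpow j K le_rfl).antisymm (h0 K)
  refine Nat.decreasingInduction (motive := fun k _ => G k = 0) (fun k _ hk => ?_) hGK
    (Nat.zero_le K)
  exact le_antisymm ((h k).trans_eq (by rw [hk, mul_zero])) (h0 k)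

/-- The majorant `(-x, -x⁻¹; r)_∞` of theta functions. -/
noncomputable def thetaMaj (x r : ℝ) : ℝ := pochMaj x r * pochMaj x⁻¹ r

lemma one_le_thetaMaj {x r : ℝ} (hx : 0 ≤ x) (h0 : 0 ≤ r) (h1 : r < 1) : 1 ≤ thetaMaj x r :=
  one_le_mul_of_one_le_of_one_le (one_le_pochMaj hx h0 h1)
    (one_le_pochMaj (inv_nonneg.2 hx) h0 h1)

lemma thetaMaj_mul_le {x r : ℝ} (hx : 0 ≤ x) (h0 : 0 < r) (h1 : r < 1) :
    thetaMaj (x * r) r ≤ (1 + (x * r)⁻¹) * thetaMaj x r := by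
  have hxr : (x * r)⁻¹ * r = x⁻¹ := by
    rw [mul_inv, mul_assoc, inv_mul_cancel₀ h0.ne', mul_one]
  have h2 := one_le_pochMaj (inv_nonneg.2 hx) h0.le h1
  have h3 : pochMaj (x * r) r ≤ pochMaj x r :=
    pochMaj_mono (by positivity) (mul_le_of_le_one_right hx h1.le) h0.le h1
  rw [thetaMaj, thetaMaj, pochMaj_eq_mul (x * r)⁻¹ h0.le h1, hxr]
  calc pochMaj (x * r) r * ((1 + (x * r)⁻¹) * pochMaj x⁻¹ r)
      ≤ pochMaj x r * ((1 + (x * r)⁻¹) * pochMaj x⁻¹ r) := by gcongr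
    _ = _ := by ring

/-- Under `w ↦ w p` theta-like growth costs a factor of order `|w|⁻¹`, which the factor `|w|³` of
the recurrence beats. -/
lemma eq_zero_of_theta_recurrence {p : ℂ} (hp0 : p ≠ 0) (hp : ‖p‖ < 1) {D : ℂ → ℂ}
    (hrec : ∀ w, w ≠ 0 → ‖D w‖ ≤ ‖w‖ ^ 3 * ‖D (w * p)‖)
    (hb : ∀ R : ℝ, ∃ C : ℝ, ∀ w, w ≠ 0 → ‖w‖ ≤ R → ‖D w‖ ≤ C * thetaMaj ‖w‖ ‖p‖)
    {w : ℂ} (hw : w ≠ 0) : D w = 0 := by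
  have hr : 0 < ‖p‖ := norm_pos_iff.2 hp0
  obtain ⟨C, hC⟩ := hb ‖w‖
  set u : ℕ → ℂ := fun k => w * p ^ k
  have hu0 : ∀ k, u k ≠ 0 := fun k => mul_ne_zero hw (pow_ne_zero _ hp0)
  have hN : ∀ k, 0 < thetaMaj ‖u k‖ ‖p‖ := fun k =>
    one_pos.trans_le (one_le_thetaMaj (norm_nonneg _) hr.le hp)
  have hlim : Tendsto (fun k => ‖u k‖) atTop (𝓝 0) := by
    simpa [u] using ((tendsto_pow_atTop_nhds_zero_of_norm_lt_one hp).const_mul w).norm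
  have hu : ∀ k, u (k + 1) = u k * p := fun k => by simp only [u]; ring
  have hle : ∀ k, ‖u k‖ ≤ ‖w‖ := fun k => norm_mul_pow_le hp le_rfl k
  have hu00 : u 0 = w := by simp [u]
  clear_value u
  -- The two summands of `ε` come from the factor `1 + (x |p|)⁻¹` in `thetaMaj_mul_le`, times `x³`.
  have key := eq_zero_of_le_mul_succ (G := fun k => ‖D (u k)‖ / thetaMaj ‖u k‖ ‖p‖)
    (ε := fun k => ‖u k‖ ^ 3 + ‖u k‖ ^ 2 * ‖p‖⁻¹) (C := C)
    (fun k => div_nonneg (norm_nonneg _) (hN k).le)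
    (fun k => (div_le_iff₀ (hN k)).2 (hC _ (hu0 k) (hle k)))
    (fun k => ?_) (by simpa using (hlim.pow 3).add ((hlim.pow 2).mul_const ‖p‖⁻¹))
  · rw [div_eq_zero_iff, norm_eq_zero] at key
    rw [← hu00]
    exact key.resolve_right (hN 0).ne'
  · have hx : 0 < ‖u k‖ := norm_pos_iff.2 (hu0 k)
    have h1 := hrec (u k) (hu0 k)
    have h2 := thetaMaj_mul_le hx.le hr hp
    have hN' := hN (k + 1)
    rw [hu, norm_mul] at hN'
    rw [div_le_iff₀ (hN k), hu, norm_mul]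
    refine h1.trans ?_
    have h3 : ‖D (u k * p)‖ = ‖D (u k * p)‖ / thetaMaj (‖u k‖ * ‖p‖) ‖p‖ *
        thetaMaj (‖u k‖ * ‖p‖) ‖p‖ := (div_mul_cancel₀ _ hN'.ne').symm
    rw [h3]
    have h4 : 0 ≤ ‖D (u k * p)‖ / thetaMaj (‖u k‖ * ‖p‖) ‖p‖ := div_nonneg (norm_nonneg _) hN'.le
    calc _ ≤ ‖u k‖ ^ 3 * (‖D (u k * p)‖ / thetaMaj (‖u k‖ * ‖p‖) ‖p‖ *
          ((1 + (‖u k‖ * ‖p‖)⁻¹) * thetaMaj ‖u k‖ ‖p‖)) := by gcongr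
      _ = _ := by field_simp

/-- A function on `ℂ` that is bounded on every disc around `0`. -/
def BddOnDiscs (f : ℂ → ℂ) : Prop := ∀ R : ℝ, ∃ C : ℝ, ∀ w : ℂ, ‖w‖ ≤ R → ‖f w‖ ≤ C

lemma BddOnDiscs.mul {f g : ℂ → ℂ} (hf : BddOnDiscs f) (hg : BddOnDiscs g) :
    BddOnDiscs fun w => f w * g w := fun R => by
  obtain ⟨A, hA⟩ := hf R
  obtain ⟨B, hB⟩ := hg R
  refine ⟨A * B, fun w hw => ?_⟩
  rw [norm_mul]
  have := (norm_nonneg _).trans (hA w hw)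
  gcongr
  exacts [hA w hw, hB w hw]

lemma bddOnDiscs_of_continuous {f : ℂ → ℂ} (hf : Continuous f) : BddOnDiscs f := fun R => by
  obtain ⟨C, hC⟩ := (isCompact_closedBall (0 : ℂ) R).exists_bound_of_continuousOn hf.continuousOn
  exact ⟨C, fun w hw => hC w (mem_closedBall_zero_iff.2 hw)⟩

/-! ### Partial theta functions -/

/-- Convergence of partial theta series: the exponent `e` of `r < 1` grows superlinearly. -/
lemma summable_pow_mul_pow {ρ r : ℝ} (hρ : 1 ≤ ρ) (h0 : 0 ≤ r) (h1 : r < 1) {d e : ℕ → ℕ}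
    (hd : ∀ n, d n ≤ n) (he : ∀ M : ℕ, ∀ᶠ n in atTop, M * n ≤ e n) :
    Summable fun n => ρ ^ d n * r ^ e n := by
  -- The series is dominated by a geometric series of ratio `ρ r^M` as soon as this is below `1`.
  have hlim : Tendsto (fun M : ℕ => ρ * r ^ M) atTop (𝓝 0) := by
    simpa using (tendsto_pow_atTop_nhds_zero_of_lt_one h0 h1).const_mul ρ
  obtain ⟨M, hM⟩ := (hlim.eventually_lt_const one_pos).exists
  refine Summable.of_norm_bounded_eventually_nat
    (summable_geometric_of_lt_one (by positivity : 0 ≤ ρ * r ^ M) hM) ?_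
  filter_upwards [he M] with n hn
  rw [Real.norm_of_nonneg (by positivity), mul_pow, ← pow_mul]
  exact mul_le_mul (pow_le_pow_right₀ hρ (hd n)) (pow_le_pow_of_le_one h0 h1.le hn)
    (by positivity) (by positivity)

section PartialTheta

variable {c : ℕ → ℂ} {d e : ℕ → ℕ} {q : ℂ}

lemma norm_partialTheta_term_le (hc : ∀ n, ‖c n‖ ≤ 1) {w : ℂ} {ρ : ℝ} (hw : ‖w‖ ≤ ρ) (n : ℕ) :
    ‖c n * w ^ d n * q ^ e n‖ ≤ ρ ^ d n * ‖q‖ ^ e n := by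
  rw [norm_mul, norm_mul, norm_pow, norm_pow]
  gcongr
  exact (mul_le_of_le_one_left (by positivity) (hc n)).trans (by gcongr)

lemma summable_partialTheta (hq : ‖q‖ < 1) (hc : ∀ n, ‖c n‖ ≤ 1) (hd : ∀ n, d n ≤ n)
    (he : ∀ M : ℕ, ∀ᶠ n in atTop, M * n ≤ e n) (w : ℂ) :
    Summable fun n => c n * w ^ d n * q ^ e n :=
  .of_norm_bounded (summable_pow_mul_pow (le_max_right ‖w‖ 1) (norm_nonneg q) hq hd he)
    (norm_partialTheta_term_le hc (le_max_left _ _))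

lemma bddOnDiscs_partialTheta (hq : ‖q‖ < 1) (hc : ∀ n, ‖c n‖ ≤ 1) (hd : ∀ n, d n ≤ n)
    (he : ∀ M : ℕ, ∀ᶠ n in atTop, M * n ≤ e n) :
    BddOnDiscs fun w => ∑' n, c n * w ^ d n * q ^ e n := fun R =>
  ⟨_, fun _ hw => tsum_of_norm_bounded
    (summable_pow_mul_pow (le_max_right R 1) (norm_nonneg q) hq hd he).hasSum
    (norm_partialTheta_term_le hc (hw.trans (le_max_left _ _)))⟩

end PartialTheta

lemma eventually_mul_le_triangular (M : ℕ) : ∀ᶠ n in atTop, M * n ≤ n * (n + 1) / 2 := by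
  filter_upwards [eventually_ge_atTop (2 * M)] with n hn
  rw [Nat.le_div_iff_mul_le two_pos]
  nlinarith

lemma eventually_mul_le_sq_sub_one_div {c : ℕ} (hc : 0 < c) (M : ℕ) :
    ∀ᶠ n in atTop, M * n ≤ (n ^ 2 - 1) / c := by
  filter_upwards [eventually_ge_atTop (c * M + 1)] with n hn
  rw [Nat.le_div_iff_mul_le hc]
  refine Nat.le_sub_of_add_le ?_
  nlinarith

lemma psi2_eq (w q : ℂ) : psi2 w q = ∑' n : ℕ, 1 * w ^ n * q ^ (n * (n + 1) / 2) := by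
  simp [psi2]

lemma bddOnDiscs_psi2 {q : ℂ} (hq : ‖q‖ < 1) : BddOnDiscs fun w => psi2 w q := by
  simp only [psi2_eq]
  exact bddOnDiscs_partialTheta hq (c := fun _ => 1) (by simp) (fun _ => le_rfl)
    eventually_mul_le_triangular

lemma psi2_eq_add_mul (w : ℂ) {q : ℂ} (hq : ‖q‖ < 1) :
    psi2 w q = 1 + w * q + w ^ 2 * q ^ 3 * psi2 (w * q ^ 2) q := by
  have hs := summable_partialTheta hq (c := fun _ => 1) (by simp) (fun _ => le_rfl)
    eventually_mul_le_triangular w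
  rw [psi2_eq, ← hs.sum_add_tsum_nat_add 2, psi2_eq, ← tsum_mul_left]
  congr 1
  · simp [Finset.sum_range_succ]
  · refine tsum_congr fun n => ?_
    have : (n + 2) * (n + 2 + 1) / 2 = n * (n + 1) / 2 + (2 * n + 3) := by
      rw [← Nat.add_mul_div_left _ _ two_pos]; ring_nf
    rw [this]
    ring

lemma kronecker_three (n : ℕ) : kronecker n 3 = jacobiSym (n % 3 : ℕ) 3 := by
  have h : padicValNat 2 3 = 0 := padicValNat.eq_zero_of_not_dvd (by norm_num)
  rw [Int.natCast_mod, Nat.cast_ofNat, kronecker, h, if_neg three_ne_zero]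
  simpa using jacobiSym.mod_left n 3

lemma norm_jacobiSym_le (a : ℤ) (b : ℕ) : ‖(jacobiSym a b : ℂ)‖ ≤ 1 := by
  rcases jacobiSym.trichotomy a b with h | h | h <;> simp [h]

lemma norm_kronecker_three_le (n : ℕ) : ‖(kronecker n 3 : ℂ)‖ ≤ 1 := by
  rw [kronecker_three]; exact norm_jacobiSym_le _ _

lemma bddOnDiscs_psi5 {q : ℂ} (hq : ‖q‖ < 1) : BddOnDiscs fun w => psi5 w q := fun R => by
  obtain ⟨C, hC⟩ := bddOnDiscs_partialTheta hq norm_kronecker_three_le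
    (fun n => Nat.sub_le n 1) (eventually_mul_le_sq_sub_one_div three_pos) R
  exact ⟨C, fun w hw => hC (-w) (by rwa [norm_neg])⟩

lemma psi5_eq_sub_mul (w : ℂ) {q : ℂ} (hq : ‖q‖ < 1) :
    psi5 w q = 1 + w * q - w ^ 3 * q ^ 5 * psi5 (w * q ^ 2) q := by
  have hs := summable_partialTheta hq norm_kronecker_three_le
    (fun n => Nat.sub_le n 1) (eventually_mul_le_sq_sub_one_div three_pos) (-w)
  rw [psi5, ← hs.sum_add_tsum_nat_add 3, psi5, sub_eq_add_neg, ← neg_mul, ← tsum_mul_left]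
  have h0 : jacobiSym 0 3 = 0 := by norm_num
  have h2 : jacobiSym 2 3 = -1 := by norm_num
  congr 1
  · simp only [Finset.sum_range_succ, kronecker_three]
    simp [h0, h2]
  · refine tsum_congr fun n => ?_
    simp only [kronecker_three, Nat.add_mod_right]
    rcases n with _ | m
    · simp [h0]
    · have : ((m + 1 + 3) ^ 2 - 1) / 3 = ((m + 1) ^ 2 - 1) / 3 + (2 * m + 5) := by
        rw [← Nat.add_mul_div_left _ _ three_pos]
        congr 1
        have : 1 ≤ (m + 1) ^ 2 := Nat.one_le_pow _ _ (by omega)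
        zify [this, this.trans (Nat.pow_le_pow_left (show m + 1 ≤ m + 1 + 3 by omega) 2)]
        ring
      rw [this, show m + 1 + 3 - 1 = m + 3 by omega, Nat.add_sub_cancel]
      ring

/-- The series `∑_{n ≥ 0} (12 / n) w^{(n-1)/2} q^{(n²-1)/24}` in the definition of `psi1`. -/
noncomputable def psi1Sum (w q : ℂ) : ℂ :=
  ∑' n : ℕ, (kronecker 12 n : ℂ) * w ^ ((n - 1) / 2) * q ^ ((n ^ 2 - 1) / 24)

lemma psi1_eq (w q : ℂ) : psi1 w q = -w - w ^ 2 * psi1Sum w q := rfl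

/-- The factor `(12 / 2) = χ₈ 12` vanishes. -/
lemma kronecker_twelve_of_even {n : ℕ} (h : Even n) : kronecker 12 n = 0 := by
  rcases eq_or_ne n 0 with rfl | hn
  · simp [kronecker]
  · have hv : padicValNat 2 n ≠ 0 :=
      Nat.one_le_iff_ne_zero.1 (one_le_padicValNat_of_dvd hn h.two_dvd)
    have h8 : ZMod.χ₈ ((12 : ℤ) : ZMod 8) = 0 := by decide
    rw [kronecker, if_neg hn, h8, zero_pow hv, zero_mul]

lemma kronecker_twelve_of_odd {n : ℕ} (h : Odd n) : kronecker 12 n = jacobiSym 12 (n % 48) := by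
  have hv : padicValNat 2 n = 0 := padicValNat.eq_zero_of_not_dvd h.not_two_dvd_nat
  rw [kronecker, if_neg h.pos.ne', hv, pow_zero, one_mul, pow_zero, Nat.div_one,
    jacobiSym.mod_right _ h]
  rfl

lemma norm_kronecker_twelve_le (n : ℕ) : ‖(kronecker 12 n : ℂ)‖ ≤ 1 := by
  rcases n.even_or_odd with h | h
  · simp [kronecker_twelve_of_even h]
  · rw [kronecker_twelve_of_odd h]; exact norm_jacobiSym_le _ _

lemma kronecker_twelve (n : ℕ) : kronecker 12 n =
    if n % 12 = 1 ∨ n % 12 = 11 then 1 else if n % 12 = 5 ∨ n % 12 = 7 then -1 else 0 := by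
  rcases n.even_or_odd with h | h
  · rw [kronecker_twelve_of_even h]
    have := Nat.even_iff.1 h
    rw [if_neg (by omega), if_neg (by omega)]
  · rw [kronecker_twelve_of_odd h]
    have h12 : n % 12 = n % 48 % 12 := by omega
    have hodd : n % 48 % 2 = 1 := by have := Nat.odd_iff.1 h; omega
    have hlt : n % 48 < 48 := Nat.mod_lt _ (by norm_num)
    rw [h12]
    generalize n % 48 = m at *
    interval_cases m <;> first | omega | norm_num

lemma kronecker_twelve_add_six (n : ℕ) : kronecker 12 (n + 6) = -kronecker 12 n := by
  simp only [kronecker_twelve]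
  have : n % 12 < 12 := Nat.mod_lt _ (by norm_num)
  rw [Nat.add_mod]
  generalize n % 12 = m at *
  interval_cases m <;> rfl

lemma bddOnDiscs_psi1Sum {q : ℂ} (hq : ‖q‖ < 1) : BddOnDiscs fun w => psi1Sum w q :=
  bddOnDiscs_partialTheta hq norm_kronecker_twelve_le
    (fun n => (Nat.div_le_self _ 2).trans (Nat.sub_le n 1))
    (eventually_mul_le_sq_sub_one_div (by norm_num))

lemma psi1Sum_eq_sub_mul (w : ℂ) {q : ℂ} (hq : ‖q‖ < 1) :
    psi1Sum w q = 1 - w ^ 2 * q - w ^ 3 * q ^ 2 * psi1Sum (w * q) q := by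
  have hs := summable_partialTheta hq norm_kronecker_twelve_le
    (fun n => (Nat.div_le_self _ 2).trans (Nat.sub_le n 1))
    (eventually_mul_le_sq_sub_one_div (show 0 < 24 by norm_num)) w
  rw [psi1Sum, ← hs.sum_add_tsum_nat_add 6, psi1Sum, sub_eq_add_neg _ (_ * _), ← neg_mul,
    ← tsum_mul_left]
  congr 1
  · simp [Finset.sum_range_succ, kronecker_twelve, sub_eq_add_neg]
  · refine tsum_congr fun n => ?_
    rw [kronecker_twelve_add_six]
    -- The floors in the exponents are harmless, as the coefficient vanishes unless `n` is coprime
    -- to `6`.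
    by_cases h0 : kronecker 12 n = 0
    · simp [h0]
    · have hn : n % 6 = 1 ∨ n % 6 = 5 := by
        rw [kronecker_twelve] at h0
        split_ifs at h0 with h1 h2
        · omega
        · omega
        · exact absurd rfl h0
      obtain ⟨m, rfl⟩ : ∃ m, n = 2 * m + 1 := ⟨n / 2, by omega⟩
      have : ((2 * m + 1 + 6) ^ 2 - 1) / 24 = ((2 * m + 1) ^ 2 - 1) / 24 + (m + 2) := by
        rw [← Nat.add_mul_div_left _ _ (show 0 < 24 by norm_num)]
        congr 1
        have h1 : 1 ≤ (2 * m + 1) ^ 2 := Nat.one_le_pow _ _ (by omega)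
        zify [h1, h1.trans (Nat.pow_le_pow_left (show 2 * m + 1 ≤ 2 * m + 1 + 6 by omega) 2)]
        ring
      rw [this, show (2 * m + 1 + 6 - 1) / 2 = m + 3 by omega,
        show (2 * m + 1 - 1) / 2 = m by omega]
      push_cast
      ring

/-! ### Inverting the base -/

lemma poch_mul_inv_sq {a q : ℂ} (ha : a ≠ 0) (hq0 : q ≠ 0) (n : ℕ) :
    poch (a * q⁻¹ ^ 2) (q⁻¹ ^ 2) n =
      (-a) ^ n * poch (a⁻¹ * q ^ 2) (q ^ 2) n / q ^ (n * (n + 1)) := by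
  induction n with
  | zero => simp [poch]
  | succ n ih =>
    rw [poch_succ, poch_succ, ih, show (n + 1) * (n + 1 + 1) = n * (n + 1) + 2 * (n + 1) by ring,
      pow_add]
    simp only [inv_pow]
    field_simp
    ring

lemma poch_mul_inv {a q : ℂ} (ha : a ≠ 0) (hq0 : q ≠ 0) (n : ℕ) :
    poch (a * q⁻¹) (q⁻¹ ^ 2) n =
      (-a) ^ n * poch (a⁻¹ * q) (q ^ 2) n / q ^ n ^ 2 := by
  induction n with
  | zero => simp [poch]
  | succ n ih =>
    rw [poch_succ, poch_succ, ih, show (n + 1) ^ 2 = n ^ 2 + (2 * n + 1) by ring, pow_add]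
    simp only [inv_pow]
    field_simp
    ring

lemma poch_inv {q : ℂ} (hq0 : q ≠ 0) (n : ℕ) :
    poch q⁻¹ (q⁻¹ ^ 2) n = (-1) ^ n * poch q (q ^ 2) n / q ^ n ^ 2 := by
  simpa using poch_mul_inv one_ne_zero hq0 n

lemma neg_pow_mul_neg_inv_pow {w : ℂ} (hw : w ≠ 0) (n : ℕ) : (-w) ^ n * (-w⁻¹) ^ n = 1 := by
  rw [← mul_pow, neg_mul_neg, mul_inv_cancel₀ hw, one_pow]

lemma KTerm_inv {w q : ℂ} (hw : w ≠ 0) (hq0 : q ≠ 0) (n : ℕ) :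
    KTerm w q⁻¹ n = (q ^ 2) ^ n * poch q (q ^ 2) n /
      (poch (w * q ^ 2) (q ^ 2) n * poch (w⁻¹ * q ^ 2) (q ^ 2) n) := by
  have hden : poch (w * q⁻¹ ^ 2) (q⁻¹ ^ 2) n * poch (w⁻¹ * q⁻¹ ^ 2) (q⁻¹ ^ 2) n =
      poch (w * q ^ 2) (q ^ 2) n * poch (w⁻¹ * q ^ 2) (q ^ 2) n / q ^ (2 * (n * (n + 1))) := by
    rw [poch_mul_inv_sq hw hq0, poch_mul_inv_sq (inv_ne_zero hw) hq0, inv_inv, two_mul, pow_add,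
      div_mul_div_comm]
    congr 1
    linear_combination (poch (w * q ^ 2) (q ^ 2) n * poch (w⁻¹ * q ^ 2) (q ^ 2) n) *
      neg_pow_mul_neg_inv_pow hw n
  have h1 : (-1 : ℂ) ^ n * (-1) ^ n = 1 := by rw [← mul_pow]; simp
  rw [KTerm, hden, poch_inv hq0, div_div_eq_mul_div]
  congr 1
  rw [show 2 * (n * (n + 1)) = n ^ 2 + n ^ 2 + 2 * n by ring, pow_add, pow_add, inv_pow, pow_mul]
  field_simp
  linear_combination poch q (q ^ 2) n * h1

lemma K1Term_inv {w q : ℂ} (hw : w ≠ 0) (hq0 : q ≠ 0) (n : ℕ) :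
    K1Term w q⁻¹ (n + 1) = q * (q ^ 2) ^ n * poch q (q ^ 2) n /
      (poch (w * q) (q ^ 2) (n + 1) * poch (w⁻¹ * q) (q ^ 2) (n + 1)) := by
  have hden : poch (w * q⁻¹) (q⁻¹ ^ 2) (n + 1) * poch (w⁻¹ * q⁻¹) (q⁻¹ ^ 2) (n + 1) =
      poch (w * q) (q ^ 2) (n + 1) * poch (w⁻¹ * q) (q ^ 2) (n + 1) / q ^ (2 * (n + 1) ^ 2) := by
    rw [poch_mul_inv hw hq0, poch_mul_inv (inv_ne_zero hw) hq0, inv_inv, two_mul,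
      pow_add q ((n + 1) ^ 2), div_mul_div_comm]
    congr 1
    linear_combination (poch (w * q) (q ^ 2) (n + 1) * poch (w⁻¹ * q) (q ^ 2) (n + 1)) *
      neg_pow_mul_neg_inv_pow hw (n + 1)
  have h1 : (-1 : ℂ) ^ n * (-1) ^ n = 1 := by rw [← mul_pow]; simp
  rw [K1Term, hden, Nat.add_sub_cancel, poch_inv hq0, div_div_eq_mul_div]
  congr 1
  rw [show q ^ (2 * (n + 1) ^ 2) = q ^ (n + 1) ^ 2 * q ^ n ^ 2 * (q ^ 2) ^ n * q by ring, inv_pow]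
  field_simp
  linear_combination poch q (q ^ 2) n * h1

lemma kappaTerm_inv {w q : ℂ} (hw : w ≠ 0) (hq0 : q ≠ 0) (n : ℕ) :
    kappaTerm w q⁻¹ n = -w⁻¹ * (w⁻¹ ^ n * poch (w⁻¹ * q ^ 2) (q ^ 2) n /
      poch (w⁻¹ * q) (q ^ 2) (n + 1)) := by
  rw [kappaTerm, poch_mul_inv_sq hw hq0, poch_mul_inv hw hq0, div_div_eq_mul_div, ← mul_div_assoc,
    mul_comm ((-w) ^ (n + 1)), ← div_div, div_right_comm, ← mul_div_assoc]
  congr 1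
  rw [show (n + 1) ^ 2 = n * (n + 1) + (n + 1) by ring, pow_add, inv_pow, inv_pow]
  have : (-w) ^ n ≠ 0 := pow_ne_zero _ (neg_ne_zero.2 hw)
  rw [pow_succ (-w)]
  field_simp
  ring

/-! ### The series `κ` -/

/-- The general term of `kappaSum`. -/
noncomputable def kappaSumTerm (q z : ℂ) (n : ℕ) : ℂ :=
  z ^ n * poch z (q ^ 2) (n + 1) * pochInf (z * q ^ 3 * (q ^ 2) ^ n) (q ^ 2)

/-- The series `(z q; q²)_∞ ∑_{n ≥ 0} z^n (z; q²)_{n+1} / (z q; q²)_{n+1}`, with the infinite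
product absorbed into the summands. -/
noncomputable def kappaSum (q z : ℂ) : ℂ := ∑' n : ℕ, kappaSumTerm q z n

lemma norm_sq_lt_one {q : ℂ} (hq : ‖q‖ < 1) : ‖q ^ 2‖ < 1 := by
  rw [norm_pow]; exact pow_lt_one₀ (norm_nonneg _) hq two_ne_zero

lemma norm_mul_pow_le_one {q z : ℂ} (hq : ‖q‖ < 1) (hz : ‖z‖ ≤ 1) (k : ℕ) : ‖z * q ^ k‖ ≤ 1 :=
  norm_mul_pow_le hq hz k

lemma norm_kappaSumTerm_le {q z : ℂ} {x : ℝ} (hq : ‖q‖ < 1) (hz : ‖z‖ ≤ x) (hx : x < 1) (n : ℕ) :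
    ‖kappaSumTerm q z n‖ ≤ x ^ n * (pochMaj 1 ‖q ^ 2‖ * pochMaj 1 ‖q ^ 2‖) := by
  have hp := norm_sq_lt_one hq
  have h1 := norm_poch_le hp (hz.trans hx.le) (n + 1)
  have h2 := norm_pochInf_le hp (norm_mul_pow_le hp (norm_mul_pow_le_one hq (hz.trans hx.le) 3) n)
  have h3 := (norm_nonneg _).trans h1
  have h4 := (norm_nonneg _).trans hz
  rw [kappaSumTerm, norm_mul, norm_mul, norm_pow, mul_assoc]
  gcongr

lemma summable_kappaSumTerm {q z : ℂ} (hq : ‖q‖ < 1) (hz : ‖z‖ < 1) :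
    Summable (kappaSumTerm q z) :=
  .of_norm_bounded ((summable_geometric_of_lt_one (norm_nonneg z) hz).mul_right _)
    (norm_kappaSumTerm_le hq le_rfl hz)

lemma norm_kappaSum_le {q z : ℂ} {x : ℝ} (hq : ‖q‖ < 1) (hz : ‖z‖ ≤ x) (hx : x < 1) :
    ‖kappaSum q z‖ ≤ (1 - x)⁻¹ * (pochMaj 1 ‖q ^ 2‖ * pochMaj 1 ‖q ^ 2‖) :=
  tsum_of_norm_bounded
    ((hasSum_geometric_of_lt_one ((norm_nonneg _).trans hz) hx).mul_right _)
    (norm_kappaSumTerm_le hq hz hx)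

/-- The relation telescopes: with `p = q²`, the difference of the summands is the forward
difference of `z^n (z p; p)_n (z² q² p^n - 1) (z q³ p^n; p)_∞`. -/
lemma kappaSum_eq_add_mul {q z : ℂ} (hq : ‖q‖ < 1) (hz : ‖z‖ < 1) :
    kappaSum q z = pochInf (z * q) (q ^ 2) * (1 + z * q) +
      z ^ 2 * q ^ 3 * (1 - z * q) * kappaSum q (z * q ^ 2) := by
  have hp := norm_sq_lt_one hq
  set C : ℕ → ℂ := fun n => z ^ n * (poch (z * q ^ 2) (q ^ 2) n *
    ((z ^ 2 * q ^ 2 * (q ^ 2) ^ n - 1) * pochInf (z * q ^ 3 * (q ^ 2) ^ n) (q ^ 2))) with hCdef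
  have hC : Tendsto C atTop (𝓝 0) := by
    have := (tendsto_pow_atTop_nhds_zero_of_norm_lt_one hz).mul ((tendsto_poch (z * q ^ 2) hp).mul
      ((((tendsto_pow_atTop_nhds_zero_of_norm_lt_one hp).const_mul (z ^ 2 * q ^ 2)).sub_const
        1).mul (tendsto_pochInf_mul_pow (z * q ^ 3) hp)))
    simpa using this
  have hz' : ‖z * q ^ 2‖ < 1 := (norm_mul_pow_le hq le_rfl 2).trans_lt hz
  have hs₁ := summable_kappaSumTerm hq hz
  have hs₂ := (summable_kappaSumTerm hq hz').mul_left (z ^ 2 * q ^ 3 * (1 - z * q))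
  have hterm : ∀ n, kappaSumTerm q z n -
      z ^ 2 * q ^ 3 * (1 - z * q) * kappaSumTerm q (z * q ^ 2) n = C (n + 1) - C n := fun n => by
    have e : z * q ^ 2 * q ^ 3 * (q ^ 2) ^ n = z * q ^ 3 * (q ^ 2) ^ n * q ^ 2 := by ring
    have e' : z * q ^ 3 * (q ^ 2) ^ (n + 1) = z * q ^ 3 * (q ^ 2) ^ n * q ^ 2 := by ring
    simp only [hCdef, kappaSumTerm, poch_succ' z, poch_succ (z * q ^ 2), e, e',
      pochInf_eq_mul (z * q ^ 3 * (q ^ 2) ^ n) hp]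
    ring
  have h := tsum_sub_of_tendsto hC ((hs₁.sub hs₂).congr hterm)
  simp only [← hterm] at h
  rw [hs₁.tsum_sub hs₂, tsum_mul_left] at h
  simp only [hCdef, poch, Finset.range_zero, Finset.prod_empty, pow_zero, mul_one, one_mul] at h
  rw [pochInf_eq_mul (z * q) hp, show z * q * q ^ 2 = z * q ^ 3 by ring, kappaSum, kappaSum]
  linear_combination h

/-- The pole-free form of the identity for `κ`. -/
lemma kappaSum_eq {q z : ℂ} (hq : ‖q‖ < 1) (hz : ‖z‖ < 1) :
    kappaSum q z = pochInf (z * q) (q ^ 2) * psi2 z q := by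
  have hp := norm_sq_lt_one hq
  -- `D` is bounded on `|z| ≤ r < 1`, so its recurrence, whose multiplier tends to `0` along the
  -- orbit `z q^(2k)`, forces `D = 0`.
  set D : ℂ → ℂ := fun z => kappaSum q z - pochInf (z * q) (q ^ 2) * psi2 z q with hD
  have hrec : ∀ z, ‖z‖ < 1 → D z = z ^ 2 * (q ^ 3 * (1 - z * q)) * D (z * q ^ 2) :=
      fun z hz => by
    simp only [hD]
    rw [kappaSum_eq_add_mul hq hz, psi2_eq_add_mul z hq, pochInf_eq_mul (z * q) hp,
      show z * q * q ^ 2 = z * q ^ 2 * q by ring]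
    ring
  obtain ⟨A, hA⟩ := bddOnDiscs_psi2 hq ‖z‖
  have hle : ∀ k, ‖z * (q ^ 2) ^ k‖ ≤ ‖z‖ := norm_mul_pow_le hp le_rfl
  have hlim : Tendsto (fun k : ℕ => ‖z * (q ^ 2) ^ k‖) atTop (𝓝 0) := by
    simpa using ((tendsto_pow_atTop_nhds_zero_of_norm_lt_one hp).const_mul z).norm
  have key := eq_zero_of_le_mul_succ (G := fun k => ‖D (z * (q ^ 2) ^ k)‖)
    (ε := fun k => ‖z * (q ^ 2) ^ k‖ ^ 2 * 2)
    (C := (1 - ‖z‖)⁻¹ * (pochMaj 1 ‖q ^ 2‖ * pochMaj 1 ‖q ^ 2‖) + pochMaj 1 ‖q ^ 2‖ * A)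
    (fun _ => norm_nonneg _) (fun k => ?_) (fun k => ?_) (by simpa using (hlim.pow 2).mul_const 2)
  · simpa [hD, sub_eq_zero] using key
  · refine (norm_sub_le _ _).trans (add_le_add (norm_kappaSum_le hq (hle k) hz) ?_)
    rw [norm_mul]
    have h1 : ‖pochInf (z * (q ^ 2) ^ k * q) (q ^ 2)‖ ≤ pochMaj 1 ‖q ^ 2‖ :=
      norm_pochInf_le hp (by simpa using norm_mul_pow_le hq ((hle k).trans hz.le) 1)
    exact mul_le_mul h1 (hA _ (hle k)) (norm_nonneg _) ((norm_nonneg _).trans h1)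
  · have h1 : ‖z * (q ^ 2) ^ k‖ < 1 := (hle k).trans_lt hz
    change ‖D _‖ ≤ _ * ‖D _‖
    rw [hrec _ h1, show z * (q ^ 2) ^ (k + 1) = z * (q ^ 2) ^ k * q ^ 2 by ring, norm_mul, norm_mul,
      norm_pow]
    gcongr
    rw [norm_mul, norm_pow]
    have h2 : ‖1 - z * (q ^ 2) ^ k * q‖ ≤ 2 := by
      refine (norm_sub_le _ _).trans ?_
      have : ‖z * (q ^ 2) ^ k * q ^ 1‖ ≤ 1 := norm_mul_pow_le hq h1.le 1
      rw [pow_one] at this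
      rw [norm_one]
      linarith
    exact (mul_le_of_le_one_left (norm_nonneg _) (pow_le_one₀ (norm_nonneg _) hq.le)).trans h2

theorem kappa_inv {w q : ℂ} (hq0 : q ≠ 0) (hq : ‖q‖ < 1) (hw : 1 < ‖w‖) :
    Summable (fun n : ℕ => kappaTerm w q⁻¹ n) ∧ kappa w q⁻¹ = 1 / (1 - w) * psi2 w⁻¹ q := by
  have hp := norm_sq_lt_one hq
  have hw0 : w ≠ 0 := norm_pos_iff.1 (one_pos.trans hw)
  have hz : ‖w⁻¹‖ < 1 := by rw [norm_inv]; exact inv_lt_one_of_one_lt₀ hw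
  have hw1 : 1 - w ≠ 0 := sub_ne_zero.2 fun h => by simp [← h] at hw
  have hP : pochInf (w⁻¹ * q) (q ^ 2) ≠ 0 := pochInf_ne_zero hp fun j h => by
    have h1 : ‖w⁻¹ * q ^ (2 * j + 1)‖ < 1 := (norm_mul_pow_le hq le_rfl _).trans_lt hz
    rw [show w⁻¹ * q ^ (2 * j + 1) = w⁻¹ * q * (q ^ 2) ^ j by ring, h, norm_one] at h1
    exact lt_irrefl _ h1
  have hterm : ∀ n, kappaTerm w q⁻¹ n =
      1 / (1 - w) / pochInf (w⁻¹ * q) (q ^ 2) * kappaSumTerm q w⁻¹ n := fun n => by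
    have h := poch_mul_pochInf (w⁻¹ * q) hp (n + 1)
    have hne : poch (w⁻¹ * q) (q ^ 2) (n + 1) ≠ 0 := fun h0 => hP (by rw [← h, h0, zero_mul])
    rw [show w⁻¹ * q * (q ^ 2) ^ (n + 1) = w⁻¹ * q ^ 3 * (q ^ 2) ^ n by ring] at h
    rw [kappaTerm_inv hw0 hq0, kappaSumTerm, poch_succ' w⁻¹, ← h]
    have h3 : pochInf (w⁻¹ * q ^ 3 * (q ^ 2) ^ n) (q ^ 2) ≠ 0 := fun h0 =>
      hP (by rw [← h, h0, mul_zero])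
    generalize pochInf (w⁻¹ * q ^ 3 * (q ^ 2) ^ n) (q ^ 2) = X at *
    generalize poch (w⁻¹ * q) (q ^ 2) (n + 1) = Y at *
    generalize poch (w⁻¹ * q ^ 2) (q ^ 2) n = Z at *
    field_simp
    ring
  simp only [kappa, hterm]
  refine ⟨(summable_kappaSumTerm hq hz).mul_left _, ?_⟩
  rw [tsum_mul_left, ← kappaSum, kappaSum_eq hq hz, ← mul_assoc, div_mul_cancel₀ _ hP]

/-! ### The series `K` and `K₁` -/

/-- The growth bound needed to apply `eq_zero_of_theta_recurrence` to the functional equations for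
`K` and `K₁`. -/
lemma exists_norm_regSum_sub_le {p B : ℂ} (hp : ‖p‖ < 1) {a b a' b' u f g : ℂ → ℂ}
    (ha : ∀ w, ‖a w‖ ≤ ‖w‖) (hb : ∀ w, ‖b w‖ ≤ ‖w‖⁻¹)
    (ha' : ∀ w, ‖a' w‖ ≤ ‖w‖) (hb' : ∀ w, ‖b' w‖ ≤ ‖w‖⁻¹)
    (hu : BddOnDiscs u) (hf : BddOnDiscs f) (hg : BddOnDiscs g) (R : ℝ) :
    ∃ C : ℝ, ∀ w, w ≠ 0 → ‖w‖ ≤ R →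
      ‖u w * regSum p B (a w) (b w) - (f w * (pochInf (a' w) p * pochInf (b' w) p) + g w)‖ ≤
        C * thetaMaj ‖w‖ ‖p‖ := by
  obtain ⟨U, hU⟩ := hu R
  obtain ⟨F, hF⟩ := hf R
  obtain ⟨G, hG⟩ := hg R
  refine ⟨U * ((1 - ‖p‖)⁻¹ * pochMaj ‖B‖ ‖p‖) + (F + G), fun w _ hw => ?_⟩
  have hU := hU w hw
  have hF := hF w hw
  have hG := hG w hw
  have h0 := (norm_nonneg _).trans hU
  have h1 := (norm_nonneg _).trans hF
  have h2 := (norm_nonneg _).trans hG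
  have hN := one_le_thetaMaj (norm_nonneg w) (norm_nonneg p) hp
  have hreg := norm_regSum_le (B := B) hp (ha w) (hb w)
  have hprod : ‖pochInf (a' w) p * pochInf (b' w) p‖ ≤ thetaMaj ‖w‖ ‖p‖ := by
    have := norm_pochInf_le hp (ha' w)
    rw [norm_mul]
    exact mul_le_mul this (norm_pochInf_le hp (hb' w)) (norm_nonneg _) ((norm_nonneg _).trans this)
  rw [add_mul, add_mul]
  refine (norm_sub_le _ _).trans (add_le_add ?_ ((norm_add_le _ _).trans (add_le_add ?_ ?_)))
  · rw [norm_mul, mul_assoc, mul_assoc]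
    exact mul_le_mul hU hreg (norm_nonneg _) h0
  · rw [norm_mul]
    exact mul_le_mul hF hprod (norm_nonneg _) h1
  · exact hG.trans (le_mul_of_one_le_right h2 hN)

section Identities

variable {q : ℂ}

/-- The pole-free form of the identity for `K`. -/
lemma regSum_eq_psi5 (hq0 : q ≠ 0) (hq : ‖q‖ < 1) {w : ℂ} (hw : w ≠ 0) :
    regSum (q ^ 2) q (w * q ^ 2) (w⁻¹ * q ^ 2) =
      (1 - w) * psi2 w q * (pochInf (w * q ^ 2) (q ^ 2) * pochInf (w⁻¹ * q ^ 2) (q ^ 2)) +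
        w * pochInf q (q ^ 2) * psi5 w q := by
  have hp := norm_sq_lt_one hq
  rw [← sub_eq_zero, ← one_mul (regSum _ _ _ _)]
  refine eq_zero_of_theta_recurrence (pow_ne_zero 2 hq0) hp
    (D := fun w => 1 * regSum (q ^ 2) q (w * q ^ 2) (w⁻¹ * q ^ 2) -
      ((1 - w) * psi2 w q * (pochInf (w * q ^ 2) (q ^ 2) * pochInf (w⁻¹ * q ^ 2) (q ^ 2)) +
        w * pochInf q (q ^ 2) * psi5 w q)) (fun w hw => ?_) ?_ hw
  · have h := regSum_contiguous (B := q) (a := w * q ^ 2) (b := w⁻¹) (k₁ := 1)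
      (k₂ := w ^ 3 * q ^ 3) (μ := w + w ^ 2 * q) hp (by field_simp; ring) (by field_simp)
    have e : (w * q ^ 2)⁻¹ * q ^ 2 = w⁻¹ := by field_simp
    have h1 := psi2_eq_add_mul w hq
    have h2 := psi5_eq_sub_mul w hq
    have h3 := pochInf_eq_mul (w * q ^ 2) hp
    have h4 := pochInf_eq_mul w⁻¹ hp
    rw [← norm_pow, ← norm_mul]
    refine le_trans (le_of_eq ?_) (mul_le_of_le_one_left (norm_nonneg _)
      (show ‖-q ^ 3‖ ≤ 1 by rw [norm_neg, norm_pow]; exact pow_le_one₀ (norm_nonneg _) hq.le))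
    rw [← norm_mul]
    congr 1
    simp only [e]
    rw [h3, h4] at h
    rw [h1, h2, h3, h4]
    linear_combination h + (1 - w * q ^ 2) * pochInf (w * q ^ 2 * q ^ 2) (q ^ 2) *
      pochInf (w⁻¹ * q ^ 2) (q ^ 2) * (1 + w * q + w ^ 2 * q ^ 3 * psi2 (w * q ^ 2) q) *
        mul_inv_cancel₀ hw
  · refine exists_norm_regSum_sub_le hp (fun w => norm_mul_pow_le hq le_rfl 2)
      (fun w => norm_mul_pow_le hq (norm_inv w).le 2) (fun w => norm_mul_pow_le hq le_rfl 2)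
      (fun w => norm_mul_pow_le hq (norm_inv w).le 2)
      (bddOnDiscs_of_continuous continuous_const)
      ((bddOnDiscs_of_continuous (by fun_prop)).mul (bddOnDiscs_psi2 hq))
      ((bddOnDiscs_of_continuous (by fun_prop)).mul (bddOnDiscs_psi5 hq))

/-- The pole-free form of the identity for `K₁`. -/
lemma sub_one_mul_regSum_eq_psi1Sum (hq0 : q ≠ 0) (hq : ‖q‖ < 1) {w : ℂ} (hw : w ≠ 0) :
    (w - 1) * q * regSum (q ^ 2) q (w * q ^ 3) (w⁻¹ * q ^ 3) =
      w * psi2 w q * (pochInf (w * q) (q ^ 2) * pochInf (w⁻¹ * q) (q ^ 2)) +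
        -w * pochInf q (q ^ 2) * psi1Sum w (q ^ 2) := by
  have hp := norm_sq_lt_one hq
  rw [← sub_eq_zero]
  refine eq_zero_of_theta_recurrence (pow_ne_zero 2 hq0) hp
    (D := fun w => (w - 1) * q * regSum (q ^ 2) q (w * q ^ 3) (w⁻¹ * q ^ 3) -
      (w * psi2 w q * (pochInf (w * q) (q ^ 2) * pochInf (w⁻¹ * q) (q ^ 2)) +
        -w * pochInf q (q ^ 2) * psi1Sum w (q ^ 2))) (fun w hw => ?_) ?_ hw
  · have h := regSum_contiguous (B := q) (a := w * q ^ 3) (b := w⁻¹ * q) (k₁ := (w - 1) * q)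
      (k₂ := w ^ 3 * q ^ 3 * (w * q ^ 2 - 1)) (μ := w * (w ^ 2 * q ^ 2 - 1)) hp
      (by field_simp; ring) (by field_simp; ring)
    have e : (w * q ^ 2)⁻¹ * q ^ 3 = w⁻¹ * q := by field_simp
    have e1 : w * q ^ 2 * q ^ 3 = w * q ^ 3 * q ^ 2 := by ring
    have e2 : w * q ^ 2 * q = w * q ^ 3 := by ring
    have e3 : w⁻¹ * q * q ^ 2 = w⁻¹ * q ^ 3 := by ring
    have e4 : w * q * q ^ 2 = w * q ^ 3 := by ring
    have e5 : (w * q ^ 2)⁻¹ * q * q ^ 2 = w⁻¹ * q := by field_simp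
    have h1 := psi2_eq_add_mul w hq
    have h2 := psi1Sum_eq_sub_mul w hp
    have h3 := pochInf_eq_mul (w * q) hp
    have h4 := pochInf_eq_mul ((w * q ^ 2)⁻¹ * q) hp
    have h5 : w * q * ((w * q ^ 2)⁻¹ * q) = 1 := by field_simp
    rw [e4] at h3
    rw [e5] at h4
    rw [e3] at h
    rw [← norm_pow, ← norm_mul]
    refine le_trans (le_of_eq ?_) (mul_le_of_le_one_left (norm_nonneg _)
      (show ‖-q ^ 2‖ ≤ 1 by rw [norm_neg]; exact hp.le))
    rw [← norm_mul]
    congr 1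
    simp only [e, e1, e2]
    rw [h1, h2, h3, h4]
    linear_combination h + w ^ 3 * q ^ 3 * psi2 (w * q ^ 2) q * pochInf (w * q ^ 3) (q ^ 2) *
      pochInf (w⁻¹ * q) (q ^ 2) * h5
  · have h1 : ∀ {a : ℂ} {x : ℝ}, ‖a‖ ≤ x → ‖a * q‖ ≤ x := fun h => by
      simpa using norm_mul_pow_le hq h 1
    exact exists_norm_regSum_sub_le hp (fun w => norm_mul_pow_le hq le_rfl 3)
      (fun w => norm_mul_pow_le hq (norm_inv w).le 3) (fun w => h1 le_rfl)
      (fun w => h1 (norm_inv w).le) (bddOnDiscs_of_continuous (by fun_prop))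
      ((bddOnDiscs_of_continuous (by fun_prop)).mul (bddOnDiscs_psi2 hq))
      ((bddOnDiscs_of_continuous (by fun_prop)).mul (bddOnDiscs_psi1Sum hp))

end Identities

/-- Divided by the infinite products, the summands of `regSum` are those of the original series. -/
lemma div_poch_mul_poch {p x y t : ℂ} (hp : ‖p‖ < 1) (hx : pochInf x p ≠ 0)
    (hy : pochInf y p ≠ 0) (n : ℕ) :
    t / (poch x p n * poch y p n) = (pochInf x p * pochInf y p)⁻¹ *
      (t * (pochInf (x * p ^ n) p * pochInf (y * p ^ n) p)) := by
  have h1 := poch_mul_pochInf x hp n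
  have h2 := poch_mul_pochInf y hp n
  rw [← h1] at hx
  rw [← h2] at hy
  rw [← h1, ← h2]
  have := left_ne_zero_of_mul hx
  have := right_ne_zero_of_mul hx
  have := left_ne_zero_of_mul hy
  have := right_ne_zero_of_mul hy
  generalize poch x p n = a at *
  generalize poch y p n = b at *
  generalize pochInf (x * p ^ n) p = c at *
  generalize pochInf (y * p ^ n) p = d at *
  field_simp

theorem K1_inv {w q : ℂ} (hq0 : q ≠ 0) (hq : ‖q‖ < 1) (hw : w ≠ 0) (hw1 : w ≠ 1)
    (hl : ∀ l : ℤ, w ≠ q ^ (2 * l + 1)) :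
    Summable (fun n : ℕ => K1Term w q⁻¹ (n + 1)) ∧
      K1 w q⁻¹ = w / (w - 1) * (psi2 w q + s1 w q) := by
  have hp := norm_sq_lt_one hq
  have hx : pochInf (w * q) (q ^ 2) ≠ 0 := pochInf_ne_zero hp fun j h => by
    refine hl (-(j + 1 : ℕ)) ?_
    rw [show 2 * -((j + 1 : ℕ) : ℤ) + 1 = -((2 * j + 1 : ℕ) : ℤ) by push_cast; ring, zpow_neg,
      zpow_natCast]
    exact eq_inv_of_mul_eq_one_left (by rw [← h]; ring)
  have hy : pochInf (w⁻¹ * q) (q ^ 2) ≠ 0 := pochInf_ne_zero hp fun j h => by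
    refine hl j ?_
    rw [show 2 * (j : ℤ) + 1 = ((2 * j + 1 : ℕ) : ℤ) by push_cast; ring, zpow_natCast]
    rw [← mul_one w, ← h]
    field_simp
    ring
  have hterm : ∀ n, K1Term w q⁻¹ (n + 1) =
      (pochInf (w * q) (q ^ 2) * pochInf (w⁻¹ * q) (q ^ 2))⁻¹ * q *
        regTerm (q ^ 2) q (w * q ^ 3) (w⁻¹ * q ^ 3) n := fun n => by
    rw [K1Term_inv hw hq0, div_poch_mul_poch hp hx hy, regTerm,
      show w * q * (q ^ 2) ^ (n + 1) = w * q ^ 3 * (q ^ 2) ^ n by ring,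
      show w⁻¹ * q * (q ^ 2) ^ (n + 1) = w⁻¹ * q ^ 3 * (q ^ 2) ^ n by ring]
    ring
  simp only [K1, hterm]
  refine ⟨(summable_regTerm hp _ _ _).mul_left _, ?_⟩
  have h := sub_one_mul_regSum_eq_psi1Sum hq0 hq hw
  have hw1' : w - 1 ≠ 0 := sub_ne_zero.2 hw1
  rw [tsum_mul_left, ← regSum, s1, psi1_eq]
  generalize pochInf (w * q) (q ^ 2) = X at *
  generalize pochInf (w⁻¹ * q) (q ^ 2) = Y at *
  generalize regSum (q ^ 2) q (w * q ^ 3) (w⁻¹ * q ^ 3) = S at *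
  field_simp
  linear_combination h

theorem K_inv {w q : ℂ} (hq0 : q ≠ 0) (hq : ‖q‖ < 1) (hw : w ≠ 0)
    (hl : ∀ l : ℤ, l ≠ 0 → w ≠ q ^ (2 * l)) :
    Summable (fun n : ℕ => KTerm w q⁻¹ n) ∧
      K w q⁻¹ = (1 - w) * psi2 w q + S5 w q := by
  have hp := norm_sq_lt_one hq
  have hx : pochInf (w * q ^ 2) (q ^ 2) ≠ 0 := pochInf_ne_zero hp fun j h => by
    refine hl (-(j + 1 : ℕ)) (by omega) ?_
    rw [show 2 * -((j + 1 : ℕ) : ℤ) = -((2 * j + 2 : ℕ) : ℤ) by push_cast; ring, zpow_neg,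
      zpow_natCast]
    exact eq_inv_of_mul_eq_one_left (by rw [← h]; ring)
  have hy : pochInf (w⁻¹ * q ^ 2) (q ^ 2) ≠ 0 := pochInf_ne_zero hp fun j h => by
    refine hl (j + 1 : ℕ) (by omega) ?_
    rw [show 2 * ((j + 1 : ℕ) : ℤ) = ((2 * j + 2 : ℕ) : ℤ) by push_cast; ring, zpow_natCast]
    rw [← mul_one w, ← h]
    field_simp
    ring
  have hterm : ∀ n, KTerm w q⁻¹ n =
      (pochInf (w * q ^ 2) (q ^ 2) * pochInf (w⁻¹ * q ^ 2) (q ^ 2))⁻¹ *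
        regTerm (q ^ 2) q (w * q ^ 2) (w⁻¹ * q ^ 2) n := fun n => by
    rw [KTerm_inv hw hq0, div_poch_mul_poch hp hx hy, regTerm]
  simp only [K, hterm]
  refine ⟨(summable_regTerm hp _ _ _).mul_left _, ?_⟩
  rw [tsum_mul_left, ← regSum, regSum_eq_psi5 hq0 hq hw, S5]
  generalize pochInf (w * q ^ 2) (q ^ 2) = X at *
  generalize pochInf (w⁻¹ * q ^ 2) (q ^ 2) = Y at *
  field_simp

end QSeries

theorem mainTheorem6 (q : ℂ) (hq0 : q ≠ 0) (hq : ‖q‖ < 1) :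
    (∀ w : ℂ, 1 < ‖w‖ → (∀ l : ℕ, w ≠ q ^ (2 * l + 1)) →
      Summable (fun n : ℕ => QSeries.kappaTerm w q⁻¹ n) ∧
      QSeries.kappa w q⁻¹ = 1 / (1 - w) * QSeries.psi2 w⁻¹ q) ∧
    (∀ w : ℂ, w ≠ 0 → w ≠ 1 → (∀ l : ℤ, w ≠ q ^ (2 * l + 1)) →
      Summable (fun n : ℕ => QSeries.K1Term w q⁻¹ (n + 1)) ∧
      QSeries.K1 w q⁻¹ = w / (w - 1) * (QSeries.psi2 w q + QSeries.s1 w q)) ∧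
    (∀ w : ℂ, w ≠ 0 → (∀ l : ℤ, l ≠ 0 → w ≠ q ^ (2 * l)) →
      Summable (fun n : ℕ => QSeries.KTerm w q⁻¹ n) ∧
      QSeries.K w q⁻¹ = (1 - w) * QSeries.psi2 w q + QSeries.S5 w q) := by
  exact ⟨fun w hw _ => QSeries.kappa_inv hq0 hq hw,
    fun w hw hw1 hl => QSeries.K1_inv hq0 hq hw hw1 hl,
    fun w hw hl => QSeries.K_inv hq0 hq hw hl⟩
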